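/- Let $S$ be a non-empty semigroup with a Hausdorff topology such that the maps $t\mapsto st$ and $t\mapsto ts$ are continuous for every $s\in S$, and let $C(S)$ be the $C^*$-algebra of bounded continuous functions $S\to\mathbb{C}$. For $s\in S$ put $(L_sf)(t)=f(st)$, $(R_sf)(t)=f(ts)$ and, for $A\subseteq S$, $s^{-1}A=\{t\in S: st\in A\}$. Let $\mathcal{F}$ be an $m$-admissible subalgebra of $C(S)$, that is, a $C^*$-subalgebra containing the constants with $L_sf,R_sf\in\mathcal{F}$ for all $f\in\mathcal{F}$ and $s\in S$, and such that for every $f\in\mathcal{F}$ and every $\mu$ in the spectrum $\Delta$ of $\mathcal{F}$ (the set of non-zero multiplicative continuous linear functionals on $\mathcal{F}$) the function $T_\mu f:s\mapsto \mu(L_sf)$ belongs to $\mathcal{F}$. Then $\Delta$ is a semigroup under $(\mu\nu)(f)=\mu(T_\nu f)$. An $\mathcal{F}$-filter is a proper filter $\varphi$ on $S$ such that for every $A\in\varphi$ with $A\neq S$ there are $B\in\varphi$ and $f\in\mathcal{F}$ with $f=0$ on $B$ and $f=1$ on $S\setminus A$; an $\mathcal{F}$-ultrafilter is an $\mathcal{F}$-filter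 that is maximal with respect to inclusion. Let $\delta S$ be the set of all $\mathcal{F}$-ultrafilters. The map sending $\mu\in\Delta$ to the filter generated by the sets $\{s\in S:|f(s)|\le r\}$, with $f\in\mathcal{F}$, $\mu(f)=0$ and $r>0$, is a bijection from $\Delta$ onto $\delta S$, and $\delta S$ carries the semigroup operation transported along it. Let $K$ be the smallest two-sided ideal of $\delta S$, and for $A\subseteq S$ let $\widehat{A}=\{p\in\delta S: A\in p\}$. A set $A\subseteq S$ is *central* if $A\in e$ for some idempotent $e\in K$; it is *syndetic* if $S=\bigcup_{s\in F}s^{-1}A$ for some finite $F\subseteq S$; it is *piecewise syndetic* if there is a finite $F\subseteq S$ such that the family $\{s^{-1}(\bigcup_{t\in F}t^{-1}A): s\in S\}$ has the finite intersection property. **Theorem.** Let $A\subseteq S$. Then the implications (i) $\Rightarrow$ (ii) $\Rightarrow$ (iii) $\Rightarrow$ (iv) hold for the following statements: (i) $\widehat{A}\cap K\neq\emptyset$. (ii) The set $\{s\in S: s^{-1}A\text{ is central}\}$ is syndetic. (iii) There exists some $s\in S$ such that $s^{-1}A$ is central. (iv) $A$ is piecewise syndetic. -/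

import Mathlib

open Filter Topology Set
open scoped BoundedContinuousFunction

noncomputable section

/-! ### Syndetic and piecewise syndetic sets, the smallest ideal of a semigroup -/

/-- The set `s⁻¹A = {t | s * t ∈ A}`. -/
def leftQuotient {S : Type*} [Mul S] (s : S) (A : Set S) : Set S := {t | s * t ∈ A}

/-- `A` is syndetic: `S = ⋃_{s ∈ F} s⁻¹A` for some finite `F ⊆ S`. -/
def IsSyndetic {S : Type*} [Mul S] (A : Set S) : Prop :=
  ∃ F : Finset S, (⋃ s ∈ F, leftQuotient s A) = univ

/-- `A` is piecewise syndetic: for some finite `F ⊆ S`, the family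
`{s⁻¹(⋃_{t ∈ F} t⁻¹A) : s ∈ S}` has the finite intersection property. -/
def IsPiecewiseSyndetic {S : Type*} [Mul S] (A : Set S) : Prop :=
  ∃ F : Finset S, ∀ G : Finset S,
    (⋂ s ∈ G, leftQuotient s (⋃ t ∈ F, leftQuotient t A)).Nonempty

/-- Non-empty two-sided ideals of a semigroup. -/
def IsTwoSidedIdeal {M : Type*} [Mul M] (I : Set M) : Prop :=
  I.Nonempty ∧ ∀ x ∈ I, ∀ m : M, m * x ∈ I ∧ x * m ∈ I

/-- The intersection of all non-empty two-sided ideals of a semigroup; it is the smallest ideal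
whenever there is one. -/
def smallestIdeal (M : Type*) [Mul M] : Set M := ⋂₀ {I | IsTwoSidedIdeal I}

/-! ### `m`-admissible subalgebras -/

section Translation

variable {S : Type*} [Semigroup S] [TopologicalSpace S] [SeparatelyContinuousMul S]

/-- `(L_s f)(t) = f (s * t)`. -/
def leftTranslate (s : S) (f : S →ᵇ ℂ) : S →ᵇ ℂ :=
  f.compContinuous ⟨fun t => s * t, SeparatelyContinuousMul.continuous_const_mul⟩

/-- `(R_s f)(t) = f (t * s)`. -/
def rightTranslate (s : S) (f : S →ᵇ ℂ) : S →ᵇ ℂ :=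
  f.compContinuous ⟨fun t => t * s, SeparatelyContinuousMul.continuous_mul_const⟩

@[simp] theorem leftTranslate_apply (s : S) (f : S →ᵇ ℂ) (t : S) :
    leftTranslate s f t = f (s * t) := rfl

@[simp] theorem rightTranslate_apply (s : S) (f : S →ᵇ ℂ) (t : S) :
    rightTranslate s f t = f (t * s) := rfl

end Translation

/-- An `m`-admissible subalgebra of the algebra of bounded continuous functions `S → ℂ`:
a norm closed, conjugation invariant subalgebra containing the constants (the constants and the
conjugation are part of `StarSubalgebra`), which is translation invariant, and such that for every
member `f` and every element `μ` of the spectrum the function `T_μ f : s ↦ μ (L_s f)` is again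
a member. The spectrum is `WeakDual.characterSpace`, the set of nonzero multiplicative
continuous functionals. -/
structure MAdmissibleSubalgebra (S : Type*) [Semigroup S] [TopologicalSpace S]
    [SeparatelyContinuousMul S] extends StarSubalgebra ℂ (S →ᵇ ℂ) where
  isClosed' : IsClosed (toStarSubalgebra : Set (S →ᵇ ℂ))
  leftTranslate_mem' : ∀ (s : S) (f : S →ᵇ ℂ), f ∈ toStarSubalgebra →
    leftTranslate s f ∈ toStarSubalgebra
  rightTranslate_mem' : ∀ (s : S) (f : S →ᵇ ℂ), f ∈ toStarSubalgebra →
    rightTranslate s f ∈ toStarSubalgebra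
  introversion_mem' : ∀ (μ : WeakDual.characterSpace ℂ toStarSubalgebra) (f : toStarSubalgebra),
    ∃ g : toStarSubalgebra, ∀ s : S,
      (g : S →ᵇ ℂ) s = μ ⟨leftTranslate s f, leftTranslate_mem' s f f.2⟩

namespace MAdmissibleSubalgebra

variable {S : Type*} [Semigroup S] [TopologicalSpace S] [SeparatelyContinuousMul S]
variable (F : MAdmissibleSubalgebra S)

/-- The spectrum `Δ` of `F`. -/
abbrev Spectrum : Type _ := WeakDual.characterSpace ℂ F.toStarSubalgebra

instance : CompleteSpace F.toStarSubalgebra := F.isClosed'.completeSpace_coe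

variable {F}

theorem ext_fun {f g : F.toStarSubalgebra} (h : ∀ s, (f : S →ᵇ ℂ) s = (g : S →ᵇ ℂ) s) : f = g :=
  Subtype.ext (BoundedContinuousFunction.ext h)

/-- `L_s` as a self-map of `F`. -/
def L (s : S) (f : F.toStarSubalgebra) : F.toStarSubalgebra :=
  ⟨leftTranslate s f, F.leftTranslate_mem' s f f.2⟩

@[simp] theorem L_apply (s : S) (f : F.toStarSubalgebra) (t : S) :
    (L s f : S →ᵇ ℂ) t = (f : S →ᵇ ℂ) (s * t) := rfl

/-- The left introversion operator `(T_μ f)(s) = μ (L_s f)`, as an algebra homomorphism. -/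
def T (μ : F.Spectrum) : F.toStarSubalgebra →ₐ[ℂ] F.toStarSubalgebra :=
  have key (f : F.toStarSubalgebra) (s : S) :
      ((F.introversion_mem' μ f).choose : S →ᵇ ℂ) s = μ (L s f) :=
    (F.introversion_mem' μ f).choose_spec s
  { toFun := fun f => (F.introversion_mem' μ f).choose
    map_one' := ext_fun fun s => (key _ s).trans (map_one μ)
    map_mul' := fun f g => ext_fun fun s => by
      change _ = ((F.introversion_mem' μ f).choose : S →ᵇ ℂ) s *
        ((F.introversion_mem' μ g).choose : S →ᵇ ℂ) s
      rw [key, key, key]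
      exact map_mul μ (L s f) (L s g)
    map_zero' := ext_fun fun s => (key _ s).trans (map_zero μ)
    map_add' := fun f g => ext_fun fun s => by
      change _ = ((F.introversion_mem' μ f).choose : S →ᵇ ℂ) s +
        ((F.introversion_mem' μ g).choose : S →ᵇ ℂ) s
      rw [key, key, key]
      exact map_add μ (L s f) (L s g)
    commutes' := fun c => ext_fun fun s => (key _ s).trans (AlgHomClass.commutes μ c) }

@[simp] theorem T_apply (μ : F.Spectrum) (f : F.toStarSubalgebra) (s : S) :
    (T μ f : S →ᵇ ℂ) s = μ (L s f) :=
  (F.introversion_mem' μ f).choose_spec s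

/-- The semigroup operation of the spectrum: `(μν)(f) = μ (T_ν f)`. -/
instance : Mul F.Spectrum where
  mul μ ν := WeakDual.CharacterSpace.equivAlgHom.symm
    ((WeakDual.CharacterSpace.toAlgHom μ).comp (T ν))

theorem spectrum_mul_apply (μ ν : F.Spectrum) (f : F.toStarSubalgebra) :
    (μ * ν) f = μ (T ν f) := rfl

instance : Semigroup F.Spectrum where
  mul_assoc μ ν κ := by
    ext f
    simp only [spectrum_mul_apply]
    congr 1
    refine ext_fun fun s => ?_
    simp only [T_apply, spectrum_mul_apply]
    congr 1
    refine ext_fun fun t => ?_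
    simp only [T_apply, L_apply]
    congr 1
    exact ext_fun fun u => by simp [mul_assoc]

/-! ### `F`-filters and `F`-ultrafilters -/

variable (F)

/-- An `F`-filter: a (proper) filter `φ` on `S` such that for every `A ∈ φ` with `A ≠ S` there are
`B ∈ φ` and `f ∈ F` with `f = 0` on `B` and `f = 1` off `A`. -/
def IsFFilter (φ : Filter S) : Prop :=
  φ.NeBot ∧ ∀ A ∈ φ, A ≠ univ → ∃ B ∈ φ, ∃ f : F.toStarSubalgebra,
    (∀ x ∈ B, (f : S →ᵇ ℂ) x = 0) ∧ ∀ x ∉ A, (f : S →ᵇ ℂ) x = 1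

/-- An `F`-ultrafilter: an `F`-filter that is maximal with respect to inclusion of the families
of sets. -/
def IsFUltrafilter (φ : Filter S) : Prop :=
  F.IsFFilter φ ∧ ∀ ψ : Filter S, F.IsFFilter ψ → φ.sets ⊆ ψ.sets → ψ = φ

/-- The space `δS` of all `F`-ultrafilters on `S`. -/
def DeltaS : Type _ := {φ : Filter S // F.IsFUltrafilter φ}

/-- `Â = {p ∈ δS : A ∈ p}`. -/
def hat (A : Set S) : Set F.DeltaS := {p | A ∈ p.1}

variable {F}

/-- `S(f, r) = {s : |f s| ≤ r}`. -/
def sublevel (f : F.toStarSubalgebra) (r : ℝ) : Set S := {s | ‖(f : S →ᵇ ℂ) s‖ ≤ r}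

/-- Continuous functions of `|f|²` belong to `F`. -/
theorem exists_comp_normSq (φ : ℝ → ℝ) (hφ : Continuous φ) (f : F.toStarSubalgebra) :
    ∃ g : F.toStarSubalgebra, ∀ s, (g : S →ᵇ ℂ) s = (φ (‖(f : S →ᵇ ℂ) s‖ ^ 2) : ℝ) := by
  have hF : IsClosed (F.toStarSubalgebra : Set (S →ᵇ ℂ)) := F.isClosed'
  let h : S →ᵇ ℂ := star (f : S →ᵇ ℂ) * f
  have hh : h ∈ F.toStarSubalgebra := mul_mem (star_mem f.2) f.2
  have hn : IsStarNormal h := (IsSelfAdjoint.star_mul_self _).isStarNormal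
  let ψ : ℂ → ℂ := fun z => (φ z.re : ℝ)
  have hψ : Continuous ψ := by fun_prop
  refine ⟨⟨cfc ψ h, cfc_mem (𝕜' := ℂ) ψ hh⟩, fun s => ?_⟩
  let ev : (S →ᵇ ℂ) →⋆ₐ[ℂ] ℂ :=
    { toFun := fun g => g s
      map_one' := rfl
      map_mul' := fun _ _ => rfl
      map_zero' := rfl
      map_add' := fun _ _ => rfl
      commutes' := fun _ => rfl
      map_star' := fun _ => rfl }
  have hev : Continuous ev := continuous_eval_const s
  have h1 : ev h = algebraMap ℂ ℂ ((‖(f : S →ᵇ ℂ) s‖ ^ 2 : ℝ) : ℂ) := by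
    change star ((f : S →ᵇ ℂ) s) * (f : S →ᵇ ℂ) s = _
    simpa using Complex.conj_mul' ((f : S →ᵇ ℂ) s)
  have h2 := StarAlgHom.map_cfc ev ψ h hψ.continuousOn hev hn (hn.map ev)
  change ev (cfc ψ h) = _
  rw [h2, h1, cfc_algebraMap]
  change ((φ _ : ℝ) : ℂ) = _
  rw [Complex.ofReal_re]

theorem sublevel_nonempty (μ : F.Spectrum) {f : F.toStarSubalgebra} (hf : μ f = 0) {r : ℝ}
    (hr : 0 < r) : (sublevel f r).Nonempty := by
  by_contra hne
  have hlt : ∀ s, r < ‖(f : S →ᵇ ℂ) s‖ := fun s => by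
    by_contra h
    exact hne ⟨s, not_lt.mp h⟩
  have hpos : ∀ x : ℝ, 0 < max x (r ^ 2) := fun x => lt_max_of_lt_right (by positivity)
  obtain ⟨g, hg⟩ := exists_comp_normSq (fun x => (max x (r ^ 2))⁻¹)
    ((continuous_id.max continuous_const).inv₀ fun x => (hpos x).ne') f
  have h1 : g * (star f * f) = 1 := by
    refine ext_fun fun s => ?_
    change (g : S →ᵇ ℂ) s * (star ((f : S →ᵇ ℂ) s) * (f : S →ᵇ ℂ) s) = 1
    have h3 : star ((f : S →ᵇ ℂ) s) * (f : S →ᵇ ℂ) s = ((‖(f : S →ᵇ ℂ) s‖ ^ 2 : ℝ) : ℂ) := by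
      simpa using Complex.conj_mul' ((f : S →ᵇ ℂ) s)
    have h4 : r ^ 2 ≤ ‖(f : S →ᵇ ℂ) s‖ ^ 2 := pow_le_pow_left₀ hr.le (hlt s).le 2
    have h5 : (‖(f : S →ᵇ ℂ) s‖ ^ 2 : ℝ) ≠ 0 := (lt_of_lt_of_le (by positivity) h4).ne'
    rw [h3, hg, max_eq_left h4, ← Complex.ofReal_mul, inv_mul_cancel₀ h5, Complex.ofReal_one]
  have h2 := congrArg μ h1
  rw [map_mul, map_mul, hf, mul_zero, mul_zero, map_one] at h2
  exact zero_ne_one h2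

/-- The filter `p(μ)` on `S` generated by the sets `S(f, r)`, `f ∈ ker μ`, `r > 0`. -/
def kerFilter (μ : F.Spectrum) : Filter S where
  sets := {A | ∃ f : F.toStarSubalgebra, μ f = 0 ∧ ∃ r : ℝ, 0 < r ∧ sublevel f r ⊆ A}
  univ_sets := ⟨0, map_zero μ, 1, one_pos, subset_univ _⟩
  sets_of_superset := fun ⟨f, hf, r, hr, h⟩ hAB => ⟨f, hf, r, hr, h.trans hAB⟩
  inter_sets := by
    rintro A B ⟨f, hf, r, hr, hA⟩ ⟨g, hg, t, ht, hB⟩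
    refine ⟨star f * f + star g * g, by simp [hf, hg], min r t ^ 2, by positivity, ?_⟩
    intro s hs
    have h1 : ‖(f : S →ᵇ ℂ) s‖ ^ 2 + ‖(g : S →ᵇ ℂ) s‖ ^ 2 ≤ min r t ^ 2 := by
      have h2 : ‖star ((f : S →ᵇ ℂ) s) * (f : S →ᵇ ℂ) s
          + star ((g : S →ᵇ ℂ) s) * (g : S →ᵇ ℂ) s‖ ≤ min r t ^ 2 := hs
      have h3 (z : ℂ) : star z * z = ((‖z‖ ^ 2 : ℝ) : ℂ) := by simpa using Complex.conj_mul' z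
      rw [h3, h3, ← Complex.ofReal_add, Complex.norm_real, Real.norm_of_nonneg (by positivity)]
        at h2
      exact h2
    have hm : 0 ≤ min r t := (lt_min hr ht).le
    refine ⟨hA ?_, hB ?_⟩
    · exact (pow_le_pow_iff_left₀ (norm_nonneg _) hm two_ne_zero).mp
        (by nlinarith [sq_nonneg ‖(g : S →ᵇ ℂ) s‖]) |>.trans (min_le_left _ _)
    · exact (pow_le_pow_iff_left₀ (norm_nonneg _) hm two_ne_zero).mp
        (by nlinarith [sq_nonneg ‖(f : S →ᵇ ℂ) s‖]) |>.trans (min_le_right _ _)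

theorem mem_kerFilter {μ : F.Spectrum} {A : Set S} :
    A ∈ kerFilter μ ↔ ∃ f : F.toStarSubalgebra, μ f = 0 ∧ ∃ r : ℝ, 0 < r ∧ sublevel f r ⊆ A :=
  Iff.rfl

theorem kerFilter_neBot (μ : F.Spectrum) : (kerFilter μ).NeBot := by
  rw [← Filter.empty_mem_iff_bot.not.trans neBot_iff.symm]
  rintro ⟨f, hf, r, hr, h⟩
  exact (sublevel_nonempty μ hf hr).not_subset_empty h

theorem isFFilter_kerFilter (μ : F.Spectrum) : F.IsFFilter (kerFilter μ) := by
  refine ⟨kerFilter_neBot μ, ?_⟩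
  rintro A ⟨f, hf, r, hr, hA⟩ -
  obtain ⟨g, hg⟩ := exists_comp_normSq
    (fun x => min 1 (max 0 (x / (r ^ 2 / 2) - 1))) (by fun_prop) f
  have hr2 : 0 < r ^ 2 / 2 := by positivity
  refine ⟨sublevel f (r / 2), ⟨f, hf, r / 2, by positivity, subset_rfl⟩, g, ?_, ?_⟩
  · intro x hx
    have h1 : ‖(f : S →ᵇ ℂ) x‖ ^ 2 ≤ (r / 2) ^ 2 := pow_le_pow_left₀ (norm_nonneg _) hx 2
    have h2 : ‖(f : S →ᵇ ℂ) x‖ ^ 2 / (r ^ 2 / 2) - 1 ≤ 0 := by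
      rw [sub_nonpos, div_le_one hr2]; nlinarith
    rw [hg, max_eq_left h2]
    simp
  · intro x hx
    have h0 : r < ‖(f : S →ᵇ ℂ) x‖ := by
      by_contra h
      exact hx (hA (not_lt.mp h))
    have h1 : r ^ 2 ≤ ‖(f : S →ᵇ ℂ) x‖ ^ 2 := pow_le_pow_left₀ hr.le h0.le 2
    have h2 : 1 ≤ ‖(f : S →ᵇ ℂ) x‖ ^ 2 / (r ^ 2 / 2) - 1 := by
      rw [le_sub_iff_add_le, le_div_iff₀ hr2]; nlinarith
    rw [hg, min_eq_left (h2.trans (le_max_right _ _))]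
    simp

theorem isFUltrafilter_kerFilter (μ : F.Spectrum) : F.IsFUltrafilter (kerFilter μ) := by
  refine ⟨isFFilter_kerFilter μ, fun ψ hψ hle => ?_⟩
  refine le_antisymm (fun A hA => hle hA) fun A hA => ?_
  by_cases hu : A = univ
  · rw [hu]; exact univ_mem
  obtain ⟨B, hB, f, hf0, hf1⟩ := hψ.2 A hA hu
  have := hψ.1
  have hz : μ f = 0 := by
    by_contra hne
    have hpos : 0 < ‖μ f‖ / 2 := by positivity
    have hmem : sublevel (f - algebraMap ℂ _ (μ f)) (‖μ f‖ / 2) ∈ ψ := hle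
      ⟨f - algebraMap ℂ _ (μ f), by rw [map_sub, AlgHomClass.commutes]; simp, _, hpos, subset_rfl⟩
    obtain ⟨x, hxB, hx⟩ := ψ.nonempty_of_mem (inter_mem hB hmem)
    have hx' : ‖(f : S →ᵇ ℂ) x - μ f‖ ≤ ‖μ f‖ / 2 := hx
    rw [hf0 x hxB, zero_sub, norm_neg] at hx'
    linarith
  refine ⟨f, hz, 1 / 2, by norm_num, fun x hx => ?_⟩
  by_contra hxA
  have hx' : ‖(f : S →ᵇ ℂ) x‖ ≤ 1 / 2 := hx
  rw [hf1 x hxA, norm_one] at hx'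
  norm_num at hx'

theorem kerFilter_injective : Function.Injective (kerFilter (F := F)) := by
  intro μ ν h
  ext f
  by_contra hne
  have hpos : 0 < ‖μ f - ν f‖ / 3 := by
    have := norm_pos_iff.mpr (sub_ne_zero.mpr hne)
    positivity
  have key (κ : F.Spectrum) : sublevel (f - algebraMap ℂ _ (κ f)) (‖μ f - ν f‖ / 3) ∈ kerFilter κ :=
    ⟨f - algebraMap ℂ _ (κ f), by rw [map_sub, AlgHomClass.commutes]; simp, _, hpos, subset_rfl⟩
  have := kerFilter_neBot μ
  obtain ⟨x, hx1, hx2⟩ := (kerFilter μ).nonempty_of_mem (inter_mem (key μ) (h ▸ key ν))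
  have h1 : ‖(f : S →ᵇ ℂ) x - μ f‖ ≤ ‖μ f - ν f‖ / 3 := hx1
  have h2 : ‖(f : S →ᵇ ℂ) x - ν f‖ ≤ ‖μ f - ν f‖ / 3 := hx2
  have h3 : ‖μ f - ν f‖ ≤ ‖(f : S →ᵇ ℂ) x - ν f‖ + ‖(f : S →ᵇ ℂ) x - μ f‖ := by
    have := norm_sub_le ((f : S →ᵇ ℂ) x - ν f) ((f : S →ᵇ ℂ) x - μ f)
    rwa [sub_sub_sub_cancel_left] at this
  linarith

theorem exists_kerFilter_eq (p : F.DeltaS) : ∃ μ : F.Spectrum, kerFilter μ = p.1 := by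
  have hp := p.2
  have := hp.1.1
  let U : Ultrafilter S := Ultrafilter.of p.1
  have hU : (U : Filter S) ≤ p.1 := Ultrafilter.of_le p.1
  have hlim (f : F.toStarSubalgebra) : ∃ c : ℂ, Tendsto (f : S →ᵇ ℂ) U (𝓝 c) := by
    obtain ⟨c, -, hc⟩ := (isCompact_closedBall (0 : ℂ) ‖(f : S →ᵇ ℂ)‖).ultrafilter_le_nhds
      (U.map (f : S →ᵇ ℂ)) (by
        rw [le_principal_iff]
        refine Filter.mem_map.mpr (Filter.univ_mem' fun x => ?_)
        simpa using (f : S →ᵇ ℂ).norm_coe_le_norm x)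
    exact ⟨c, hc⟩
  choose l hl using hlim
  let φ : F.toStarSubalgebra →ₐ[ℂ] ℂ :=
    { toFun := l
      map_one' := tendsto_nhds_unique (hl 1) tendsto_const_nhds
      map_mul' := fun f g => tendsto_nhds_unique (hl (f * g)) ((hl f).mul (hl g))
      map_zero' := tendsto_nhds_unique (hl 0) tendsto_const_nhds
      map_add' := fun f g => tendsto_nhds_unique (hl (f + g)) ((hl f).add (hl g))
      commutes' := fun c => tendsto_nhds_unique (hl (algebraMap ℂ _ c)) tendsto_const_nhds }
  let μ : F.Spectrum := WeakDual.CharacterSpace.equivAlgHom.symm φ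
  refine ⟨μ, hp.2 _ (isFFilter_kerFilter μ) fun A hA => ?_⟩
  by_cases hu : A = univ
  · rw [hu]; exact (kerFilter μ).univ_sets
  obtain ⟨B, hB, f, hf0, hf1⟩ := hp.1.2 A hA hu
  have hz : μ f = 0 := by
    refine tendsto_nhds_unique (hl f) (tendsto_const_nhds.congr' ?_)
    filter_upwards [hU hB] with x hx using (hf0 x hx).symm
  refine ⟨f, hz, 1 / 2, by norm_num, fun x hx => ?_⟩
  by_contra hxA
  have hx' : ‖(f : S →ᵇ ℂ) x‖ ≤ 1 / 2 := hx
  rw [hf1 x hxA, norm_one] at hx'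
  norm_num at hx'

variable (F)

/-- The canonical bijection `μ ↦ p(μ)` from the spectrum onto `δS`. -/
def spectrumEquiv : F.Spectrum ≃ F.DeltaS :=
  Equiv.ofBijective (fun μ => ⟨kerFilter μ, isFUltrafilter_kerFilter μ⟩)
    ⟨fun _ _ h => kerFilter_injective (congrArg Subtype.val h),
      fun p => (exists_kerFilter_eq p).imp fun _ h => Subtype.ext h⟩

/-- The semigroup operation of `δS`, carried over from the spectrum along `μ ↦ p(μ)`. -/
instance : Semigroup F.DeltaS := F.spectrumEquiv.symm.semigroup

/-- The smallest ideal `K` of `δS`. -/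
def K : Set F.DeltaS := smallestIdeal F.DeltaS

/-- `A` is central (with respect to `F`): it belongs to some idempotent of `K`. -/
def IsCentral (A : Set S) : Prop := ∃ e ∈ F.K, IsIdempotentElem e ∧ A ∈ e.1

end MAdmissibleSubalgebra

end

/-! Work in the spectrum Δ, a compact right topological semigroup isomorphic to δS. A point μ of its
smallest ideal with A ∈ p(μ) lies in a compact minimal left ideal J; choose f with μ(f) = 0 and S(f,
r) ⊆ A. For ν ∈ J write μ = κν: then κ(T_ν f) = 0, so |ν(L_s f)| < r for some s ∈ S. These
conditions are open in ν, so by compactness finitely many s, forming G, serve all of J. Multiplying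
ν on the left by the evaluation at t stays in J, and gives (st)⁻¹A ∈ p(ν) for every t, with some s ∈
G depending on t and ν.

This uniform statement, `exists_finset_leftQuotient_mem`, yields both substantial implications. With
ν an idempotent of J it says that G witnesses (ii). With any ν ∈ J it puts all sets t⁻¹(⋃_{s ∈ G}
s⁻¹A) into one proper filter, so A is piecewise syndetic; for (iii) ⇒ (iv) this is applied to s⁻¹A
and the extra translation is absorbed. -/

/-! ### Minimal left ideals of compact right topological semigroups -/

section RightTopological

variable {M : Type*} [Semigroup M] [TopologicalSpace M] [CompactSpace M] [T2Space M]

/-- A compact right topological semigroup has a non-empty compact left ideal which is generated by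
each of its elements. -/
theorem exists_minimal_left_ideal [Nonempty M] (hM : ∀ r : M, Continuous (· * r)) :
    ∃ L : Set M, L.Nonempty ∧ IsCompact L ∧ (∀ m : M, ∀ q ∈ L, m * q ∈ L) ∧
      ∀ q ∈ L, ∀ p ∈ L, ∃ m : M, m * q = p := by
  let 𝓛 : Set (Set M) := {L | IsClosed L ∧ L.Nonempty ∧ ∀ m : M, ∀ q ∈ L, m * q ∈ L}
  obtain ⟨L, hL⟩ : ∃ L, Minimal (· ∈ 𝓛) L := by
    refine zorn_superset 𝓛 fun c hc hchain => ?_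
    -- The empty chain has empty intersection of conditions, so the whole semigroup serves as its
    -- lower bound.
    rcases c.eq_empty_or_nonempty with rfl | hne
    · exact ⟨univ, ⟨isClosed_univ, univ_nonempty, fun _ _ _ => mem_univ _⟩, by simp⟩
    have := hne.to_subtype
    refine ⟨⋂₀ c, ⟨isClosed_sInter fun s hs => (hc hs).1, ?_, fun m q hq s hs =>
      (hc hs).2.2 m q (hq s hs)⟩, fun s hs => sInter_subset_of_mem hs⟩
    rw [sInter_eq_iInter]
    exact IsCompact.nonempty_iInter_of_directed_nonempty_isCompact_isClosed _
      (fun s t => (hchain.total s.2 t.2).elim (fun h => ⟨s, subset_rfl, h⟩)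
        fun h => ⟨t, h, subset_rfl⟩)
      (fun s => (hc s.2).2.1)
      (fun s => (hc s.2).1.isCompact) fun s => (hc s.2).1
  obtain ⟨hcl, hne, hid⟩ := hL.prop
  refine ⟨L, hne, hcl.isCompact, hid, fun q hq p hp => ?_⟩
  -- Mq is a closed left ideal inside L, so minimality forces Mq = L.
  have hmem : range (· * q) ∈ 𝓛 := by
    refine ⟨(isCompact_range (hM q)).isClosed, ⟨q * q, q, rfl⟩, ?_⟩
    rintro m _ ⟨x, rfl⟩
    exact ⟨m * x, mul_assoc m x q⟩
  exact hL.le_of_le hmem (by rintro _ ⟨x, rfl⟩; exact hid x q hq) hp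

/-- Every point of the smallest ideal of a compact right topological semigroup lies in a compact
left ideal which is contained in the smallest ideal and generated by each of its elements. -/
theorem exists_minimal_left_ideal_of_mem_smallestIdeal (hM : ∀ r : M, Continuous (· * r))
    {p : M} (hp : p ∈ smallestIdeal M) :
    ∃ L : Set M, p ∈ L ∧ IsCompact L ∧ L ⊆ smallestIdeal M ∧ (∀ m : M, ∀ q ∈ L, m * q ∈ L) ∧
      ∀ q ∈ L, ∃ m : M, m * q = p := by
  have : Nonempty M := ⟨p⟩
  obtain ⟨L, ⟨l, hl⟩, hcomp, hid, hgen⟩ := exists_minimal_left_ideal hM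
  -- LM is a two-sided ideal, so p factors as xy with x ∈ L; the required left ideal is Ly.
  have hideal : IsTwoSidedIdeal {y : M | ∃ x ∈ L, ∃ m : M, x * m = y} := by
    refine ⟨⟨l * l, l, hl, l, rfl⟩, ?_⟩
    rintro _ ⟨x, hx, m, rfl⟩ n
    exact ⟨⟨n * x, hid n x hx, m, mul_assoc n x m⟩, ⟨x, hx, m * n, (mul_assoc x m n).symm⟩⟩
  obtain ⟨x, hx, y, rfl⟩ := hp _ hideal
  refine ⟨(· * y) '' L, mem_image_of_mem _ hx, hcomp.image (hM y), ?_, ?_, ?_⟩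
  -- L lies in every ideal I: for i ∈ I and z ∈ L, the element iz generates L, so z = m(iz) ∈ I.
  · rintro _ ⟨z, hz, rfl⟩ I hI
    obtain ⟨i, hi⟩ := hI.1
    obtain ⟨m, hm⟩ := hgen (i * z) (hid i z hz) z hz
    exact (hI.2 z (hm ▸ (hI.2 _ (hI.2 i hi z).2 m).1) y).2
  · rintro m _ ⟨z, hz, rfl⟩
    exact ⟨m * z, hid m z hz, mul_assoc m z y⟩
  · rintro _ ⟨z, hz, rfl⟩
    obtain ⟨m, rfl⟩ := hgen z hz x hx
    exact ⟨m, (mul_assoc m z y).symm⟩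

end RightTopological

/-! ### Invariance of the smallest ideal under isomorphism -/

theorem MulEquiv.preimage_isTwoSidedIdeal {M N : Type*} [Mul M] [Mul N] (e : M ≃* N) {I : Set N}
    (hI : IsTwoSidedIdeal I) : IsTwoSidedIdeal (e ⁻¹' I) := by
  refine ⟨hI.1.preimage e.surjective, fun x hx m => ?_⟩
  simpa only [mem_preimage, map_mul] using hI.2 (e x) hx (e m)

theorem MulEquiv.apply_mem_smallestIdeal {M N : Type*} [Mul M] [Mul N] (e : M ≃* N) {x : M}
    (hx : x ∈ smallestIdeal M) : e x ∈ smallestIdeal N :=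
  fun _ hI => hx _ (e.preimage_isTwoSidedIdeal hI)

/-! ### Translates of A along a minimal left ideal of the spectrum -/

namespace MAdmissibleSubalgebra

variable {S : Type*} [Semigroup S] [TopologicalSpace S] [SeparatelyContinuousMul S]
variable {F : MAdmissibleSubalgebra S}

theorem continuous_spectrum_apply (f : F.toStarSubalgebra) :
    Continuous fun μ : F.Spectrum => μ f :=
  (WeakDual.eval_continuous f).comp continuous_subtype_val

theorem continuous_spectrum_mul_right (ν : F.Spectrum) : Continuous fun μ : F.Spectrum => μ * ν :=
  Continuous.subtype_mk (WeakDual.continuous_of_continuous_eval fun f =>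
    continuous_spectrum_apply (T ν f)) _

/-- Evaluation at a point of `S`, as an element of the spectrum. -/
noncomputable def evalSpectrum (F : MAdmissibleSubalgebra S) (s : S) : F.Spectrum :=
  WeakDual.CharacterSpace.equivAlgHom.symm
    { toFun := fun f => (f : S →ᵇ ℂ) s
      map_one' := rfl
      map_mul' := fun _ _ => rfl
      map_zero' := rfl
      map_add' := fun _ _ => rfl
      commutes' := fun _ => rfl }

theorem evalSpectrum_mul_apply (s : S) (ν : F.Spectrum) (f : F.toStarSubalgebra) :
    (evalSpectrum F s * ν) f = ν (L s f) :=
  T_apply ν f s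

theorem L_L (s t : S) (f : F.toStarSubalgebra) : L t (L s f) = L (s * t) f :=
  ext_fun fun u => by simp [mul_assoc]

/-- L_s f minus its value at μ lies in ker μ; where it is at most r − |μ(L_s f)|, the triangle
inequality gives |f(sx)| ≤ r. -/
theorem leftQuotient_mem_kerFilter {f : F.toStarSubalgebra} {r : ℝ} {A : Set S}
    (hA : sublevel f r ⊆ A) {s : S} {μ : F.Spectrum} (h : ‖μ (L s f)‖ < r) :
    leftQuotient s A ∈ kerFilter μ := by
  refine ⟨L s f - algebraMap ℂ _ (μ (L s f)), by rw [map_sub, AlgHomClass.commutes]; simp,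
    r - ‖μ (L s f)‖, sub_pos.mpr h, fun x hx => hA ?_⟩
  have h1 : ‖(f : S →ᵇ ℂ) (s * x) - μ (L s f)‖ ≤ r - ‖μ (L s f)‖ := hx
  have h2 := norm_le_norm_sub_add ((f : S →ᵇ ℂ) (s * x)) (μ (L s f))
  change ‖(f : S →ᵇ ℂ) (s * x)‖ ≤ r
  linarith

/-- The bijection from the spectrum onto `δS`, as an isomorphism of semigroups. -/
noncomputable def spectrumMulEquiv (F : MAdmissibleSubalgebra S) : F.Spectrum ≃* F.DeltaS :=
  (F.spectrumEquiv.symm.mulEquiv).symm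

/-- If `A` belongs to a point of the smallest ideal, then finitely many translates of `A` cover
a compact left ideal contained in the smallest ideal, in the following strong sense. -/
theorem exists_finset_leftQuotient_mem {A : Set S} (h : (F.hat A ∩ F.K).Nonempty) :
    ∃ J : Set F.Spectrum, J.Nonempty ∧ IsCompact J ∧ J ⊆ smallestIdeal F.Spectrum ∧
      (∀ μ : F.Spectrum, ∀ ν ∈ J, μ * ν ∈ J) ∧
      ∃ G : Finset S, ∀ ν ∈ J, ∀ t : S, ∃ s ∈ G, leftQuotient (s * t) A ∈ kerFilter ν := by
  obtain ⟨p, hpA, hpK⟩ := h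
  obtain ⟨μ, rfl⟩ := F.spectrumMulEquiv.surjective p
  have hμ : μ ∈ smallestIdeal F.Spectrum := by
    simpa using F.spectrumMulEquiv.symm.apply_mem_smallestIdeal hpK
  obtain ⟨J, hμL, hcomp, hLK, hid, hgen⟩ :=
    exists_minimal_left_ideal_of_mem_smallestIdeal continuous_spectrum_mul_right hμ
  obtain ⟨f, hf, r, hr, hA⟩ : A ∈ kerFilter μ := hpA
  obtain ⟨G, hG⟩ := hcomp.elim_finite_subcover (fun s : S => {ν : F.Spectrum | ‖ν (L s f)‖ < r})
    (fun s => isOpen_lt (continuous_spectrum_apply _).norm continuous_const) (by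
      intro ν hν
      obtain ⟨κ, rfl⟩ := hgen ν hν
      -- Since (κν)(f) = κ(T_ν f), `hf` says that T_ν f ∈ ker κ. The radius r / 2 yields the strict
      -- inequality of the open cover.
      obtain ⟨s, hs⟩ := sublevel_nonempty κ (f := T ν f) hf (half_pos hr)
      have hs' : ‖(T ν f : S →ᵇ ℂ) s‖ ≤ r / 2 := hs
      rw [T_apply] at hs'
      exact mem_iUnion.mpr ⟨s, hs'.trans_lt (half_lt_self hr)⟩)
  refine ⟨J, ⟨μ, hμL⟩, hcomp, hLK, hid, G, fun ν hν t => ?_⟩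
  -- The cover is applied to the product of evaluation at t with ν, whose value at L_s f is ν(L_{st}
  -- f).
  obtain ⟨s, hs, hlt⟩ := mem_iUnion₂.mp (hG (hid (evalSpectrum F t) ν hν))
  refine ⟨s, hs, leftQuotient_mem_kerFilter hA ?_⟩
  rwa [mem_ofPred_eq, evalSpectrum_mul_apply, L_L] at hlt

/-- One idempotent e of the left ideal witnesses the centrality of (st)⁻¹A for every t, with s in
the fixed finite set G. -/
theorem isSyndetic_setOf_isCentral {A : Set S} (h : (F.hat A ∩ F.K).Nonempty) :
    IsSyndetic {s : S | F.IsCentral (leftQuotient s A)} := by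
  obtain ⟨L, hne, hcomp, hLK, hid, G, hG⟩ := exists_finset_leftQuotient_mem h
  obtain ⟨e, he, hee⟩ := exists_idempotent_in_compact_subsemigroup continuous_spectrum_mul_right
    L hne hcomp fun x _ y hy => hid x y hy
  refine ⟨G, eq_univ_of_forall fun t => ?_⟩
  obtain ⟨s, hs, hst⟩ := hG e he t
  exact mem_iUnion₂.mpr ⟨s, hs, F.spectrumMulEquiv e,
    F.spectrumMulEquiv.apply_mem_smallestIdeal (hLK he),
    (map_mul F.spectrumMulEquiv e e).symm.trans (congrArg _ hee), hst⟩

/-- The finite intersection property holds because a single proper filter p(ν) contains the whole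
family. -/
theorem isPiecewiseSyndetic_of_hat_inter_K {A : Set S} (h : (F.hat A ∩ F.K).Nonempty) :
    IsPiecewiseSyndetic A := by
  obtain ⟨L, ⟨ν, hν⟩, -, -, -, G, hG⟩ := exists_finset_leftQuotient_mem h
  have := kerFilter_neBot ν
  refine ⟨G, fun H => (kerFilter ν).nonempty_of_mem ?_⟩
  refine (Filter.biInter_finset_mem H).mpr fun t _ => ?_
  obtain ⟨s, hs, hst⟩ := hG ν hν t
  refine mem_of_superset hst fun x hx => mem_iUnion₂.mpr ⟨s, hs, ?_⟩
  change s * (t * x) ∈ A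
  rw [← mul_assoc]
  exact hx

end MAdmissibleSubalgebra

/-! ### Removing a translation, and the theorem -/

theorem IsPiecewiseSyndetic.of_leftQuotient {S : Type*} [Semigroup S] {s : S} {A : Set S}
    (h : IsPiecewiseSyndetic (leftQuotient s A)) : IsPiecewiseSyndetic A := by
  classical
  obtain ⟨F, hF⟩ := h
  -- As u⁻¹(s⁻¹A) = (su)⁻¹A, the finite set sF works for A.
  refine ⟨F.image (s * ·), fun G => (hF G).mono ?_⟩
  refine iInter₂_mono fun t _ x hx => ?_
  obtain ⟨u, hu, hx⟩ := mem_iUnion₂.mp hx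
  refine mem_iUnion₂.mpr ⟨s * u, Finset.mem_image_of_mem _ hu, ?_⟩
  change s * u * (t * x) ∈ A
  rw [mul_assoc]
  exact hx

theorem IsSyndetic.nonempty {S : Type*} [Mul S] [Nonempty S] {A : Set S} (h : IsSyndetic A) :
    A.Nonempty := by
  obtain ⟨F, hF⟩ := h
  obtain ⟨t⟩ := ‹Nonempty S›
  obtain ⟨s, -, hs⟩ := mem_iUnion₂.mp (hF ▸ mem_univ t)
  exact ⟨s * t, hs⟩

theorem mainTheorem8 {S : Type*} [Semigroup S] [Nonempty S] [TopologicalSpace S] [T2Space S]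
    [SeparatelyContinuousMul S] (F : MAdmissibleSubalgebra S) (A : Set S) :
    ((F.hat A ∩ F.K).Nonempty → IsSyndetic {s : S | F.IsCentral (leftQuotient s A)}) ∧
    (IsSyndetic {s : S | F.IsCentral (leftQuotient s A)} →
      ∃ s : S, F.IsCentral (leftQuotient s A)) ∧
    ((∃ s : S, F.IsCentral (leftQuotient s A)) → IsPiecewiseSyndetic A) := by
  refine ⟨MAdmissibleSubalgebra.isSyndetic_setOf_isCentral, fun h => h.nonempty, ?_⟩
  rintro ⟨s, e, heK, -, he⟩
  exact (MAdmissibleSubalgebra.isPiecewiseSyndetic_of_hat_inter_K ⟨e, he, heK⟩).of_leftQuotient
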